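/- Let $X$ be a metrizable topological space. Call $X$ completely Baire if every closed subspace of $X$ is a Baire space (that is, countable intersections of its dense open subsets are dense in it). Call a set $E\subseteq X$ a $\mathbf{\Delta}^0_2$-set if it is both an $F_\sigma$-set and a $G_\delta$-set in $X$. Call $E$ resolvable if $$E=(F_0\setminus F_1)\cup(F_2\setminus F_3)\cup\dots\cup(F_\xi\setminus F_{\xi+1})\cup\dots\qquad(\xi\text{ even}),$$ where $\langle F_\xi\rangle$ is a (not necessarily strictly) decreasing transfinite sequence of closed subsets of $X$, and an ordinal is even if it has the form $\lambda+2n$ with $\lambda$ zero or a limit ordinal and $n<\omega$. Then the following conditions are equivalent: (i) no closed subspace of $X$ is homeomorphic to the space $\mathbb{Q}$ of rational numbers; (ii) $X$ is completely Baire; (iii) a subset of $X$ is a $\mathbf{\Delta}^0_2$-set if and only if it is resolvable. -/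

import Mathlib

universe u

/-- An `F_σ` set: a union of countably many closed sets. -/
def IsFSigmaSet {X : Type u} [TopologicalSpace X] (E : Set X) : Prop :=
  ∃ C : ℕ → Set X, (∀ n, IsClosed (C n)) ∧ E = ⋃ n, C n

/-- A `Δ⁰₂` set: a set that is both `F_σ` and `G_δ`. -/
def IsDeltaZeroTwo {X : Type u} [TopologicalSpace X] (E : Set X) : Prop :=
  IsFSigmaSet E ∧ IsGδ E

/-- A resolvable set: `E = (F₀ \ F₁) ∪ (F₂ \ F₃) ∪ … ∪ (F_ω \ F_{ω+1}) ∪ …` for a decreasing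
transfinite sequence of closed sets. The ordinals `2 * ξ` are exactly the even ordinals
`l + 2n` (`l` zero or a limit, `n` finite), so each term of the union is `F_η \ F_{η+1}` with
`η` even; `α` bounds the length of the union. -/
def IsResolvableSet {X : Type u} [TopologicalSpace X] (E : Set X) : Prop :=
  ∃ (α : Ordinal.{u}) (F : Ordinal.{u} → Set X),
    (∀ ξ, IsClosed (F ξ)) ∧ Antitone F ∧
      E = ⋃ ξ ∈ Set.Iio α, F (2 * ξ) \ F (2 * ξ + 1)

/-- A completely Baire space: every closed subspace is a Baire space. -/
def IsCompletelyBaire (X : Type u) [TopologicalSpace X] : Prop :=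
  ∀ F : Set X, IsClosed F → BaireSpace F

open Set Filter Topology

/-! A resolvable set is a union of exit layers: each point outside the intersection of the sequence
leaves at a unique first stage, and any union of such layers is `F_σ` in a metric space. So
resolvable sets are always `Δ⁰₂`.

Conversely, take closures alternately of the part in `E` and the part outside `E`. This stabilizes
at a closed `K` in which `E` and `Eᶜ` are both dense. If `E` is `Δ⁰₂`, both traces are dense `G_δ`,
so the Baire property of `K` makes `K` empty, and the derivation resolves `E`.

A closed copy of `ℚ` splits into two countable dense parts. Each is `Δ⁰₂` in `X`, but a resolvable
set cannot be dense and codense in a nonempty closed set.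

If a closed subspace is not Baire, some ball misses `⋂ G k` for dense open `G k`. Grow a tree of
points in it, the children of each point lying in disjoint closed balls that converge to it and lie
in the current `G k`. A limit point off the tree would lie in every `G k`, so the tree is closed.
Its topology depends only on the combinatorics of finite sequences, and `treePos` realizes the same
combinatorics in `ℚ`. -/

theorem isFSigmaSet_iff_isGδ_compl {X : Type u} [TopologicalSpace X] {E : Set X} :
    IsFSigmaSet E ↔ IsGδ Eᶜ := by
  rw [isGδ_iff_eq_iInter_nat]
  constructor
  · rintro ⟨C, hC, rfl⟩
    exact ⟨fun n => (C n)ᶜ, fun n => (hC n).isOpen_compl, compl_iUnion C⟩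
  · rintro ⟨f, hf, h⟩
    refine ⟨fun n => (f n)ᶜ, fun n => (hf n).isClosed_compl, ?_⟩
    rw [← compl_iInter, ← h, compl_compl]

theorem isDeltaZeroTwo_iff {X : Type u} [TopologicalSpace X] {E : Set X} :
    IsDeltaZeroTwo E ↔ IsGδ Eᶜ ∧ IsGδ E := by
  rw [IsDeltaZeroTwo, isFSigmaSet_iff_isGδ_compl]

/-! ### Exit layers and resolvable sets -/

/-- The points that leave the transfinite sequence `F` exactly at the stage `ξ`. -/
def exitLayer {X : Type u} (F : Ordinal.{u} → Set X) (ξ : Ordinal.{u}) : Set X :=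
  {x | x ∉ F ξ ∧ ∀ η < ξ, x ∈ F η}

theorem eq_of_mem_exitLayer {X : Type u} {F : Ordinal.{u} → Set X} {ξ η : Ordinal.{u}} {x : X}
    (hξ : x ∈ exitLayer F ξ) (hη : x ∈ exitLayer F η) : ξ = η := by
  rcases lt_trichotomy ξ η with h | h | h
  · exact absurd (hη.2 ξ h) hξ.1
  · exact h
  · exact absurd (hξ.2 η h) hη.1

theorem exists_mem_exitLayer {X : Type u} {F : Ordinal.{u} → Set X} {x : X} {ξ : Ordinal.{u}}
    (h : x ∉ F ξ) : ∃ η ≤ ξ, x ∈ exitLayer F η := by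
  induction ξ using WellFoundedLT.induction with
  | ind ξ ih =>
    by_cases hx : ∀ η < ξ, x ∈ F η
    · exact ⟨ξ, le_rfl, h, hx⟩
    · push Not at hx
      obtain ⟨η, hη, hxη⟩ := hx
      obtain ⟨ζ, hζ, hxζ⟩ := ih η hη hxη
      exact ⟨ζ, hζ.trans hη.le, hxζ⟩

/-- In a metric space, any union of exit layers of a sequence of closed sets is `F_σ`. -/
theorem isFSigmaSet_iUnion_exitLayer {X : Type u} [MetricSpace X] {F : Ordinal.{u} → Set X}
    (hF : ∀ ξ, IsClosed (F ξ)) (A : Set Ordinal.{u}) :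
    IsFSigmaSet (⋃ ξ ∈ A, exitLayer F ξ) := by
  refine ⟨fun n => {x | ∃ ξ ∈ A, (∀ η < ξ, x ∈ F η) ∧
    ∀ w ∈ F ξ, 1 / ((n : ℝ) + 1) ≤ dist x w}, fun n => ?_, ?_⟩
  · set δ : ℝ := 1 / ((n : ℝ) + 1) with hδ
    have hδ0 : 0 < δ := by positivity
    refine isClosed_of_closure_subset fun x hx => ?_
    rw [Metric.mem_closure_iff] at hx
    obtain ⟨y, ⟨ξ, hξA, hyF, hyd⟩, hxy⟩ := hx (δ / 2) (half_pos hδ0)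
    -- Points of the `n`th piece closer than `δ` share their exit stage: the one leaving later still
    -- lies in the closed set that the other avoids by `δ`.
    have key : ∀ ε > 0, ∃ z, dist x z < ε ∧ (∀ η < ξ, z ∈ F η) ∧ ∀ w ∈ F ξ, δ ≤ dist z w := by
      intro ε hε
      obtain ⟨z, ⟨ζ, -, hzF, hzd⟩, hxz⟩ := hx (min ε (δ / 2)) (lt_min hε (half_pos hδ0))
      have hyz : dist y z < δ := by
        have := dist_triangle_left y z x
        have := hxz.trans_le (min_le_right _ _)
        linarith
      have : ζ = ξ := by
        rcases lt_trichotomy ζ ξ with h | h | h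
        · have := hzd y (hyF ζ h)
          rw [dist_comm] at this
          linarith
        · exact h
        · have := hyd z (hzF ξ h)
          linarith
      subst this
      exact ⟨z, hxz.trans_le (min_le_left _ _), hzF, hzd⟩
    refine ⟨ξ, hξA, fun η hη => ?_, fun w hw => ?_⟩
    · rw [← (hF η).closure_eq, Metric.mem_closure_iff]
      intro ε hε
      obtain ⟨z, hz, hzF, -⟩ := key ε hε
      exact ⟨z, hzF η hη, hz⟩
    · refine le_of_forall_pos_le_add fun ε hε => ?_
      obtain ⟨z, hz, -, hzd⟩ := key ε hε
      have := hzd w hw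
      have := dist_triangle_left z w x
      linarith
  · ext x
    simp only [mem_iUnion, mem_ofPred_eq, exists_prop]
    constructor
    · rintro ⟨ξ, hξ, hx, hxF⟩
      obtain ⟨ε, hε, hb⟩ := Metric.isOpen_iff.1 (hF ξ).isOpen_compl x hx
      obtain ⟨n, hn⟩ := exists_nat_one_div_lt hε
      refine ⟨n, ξ, hξ, hxF, fun w hw => ?_⟩
      by_contra! hlt
      exact hb (by rw [Metric.mem_ball, dist_comm]; exact hlt.trans hn) hw
    · rintro ⟨n, ξ, hξ, hxF, hd⟩
      refine ⟨ξ, hξ, fun hx => ?_, hxF⟩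
      have := hd x hx
      rw [dist_self] at this
      have : (0 : ℝ) < 1 / ((n : ℝ) + 1) := by positivity
      linarith

theorem iUnion_sdiff_eq_iUnion_exitLayer {X : Type u} {F : Ordinal.{u} → Set X}
    (hF : Antitone F) (α : Ordinal.{u}) :
    ⋃ ξ ∈ Iio α, F (2 * ξ) \ F (2 * ξ + 1) =
      ⋃ ξ ∈ (fun ξ => 2 * ξ + 1) '' Iio α, exitLayer F ξ := by
  rw [biUnion_image]
  refine iUnion₂_congr fun ξ _ => ?_
  ext x
  constructor
  · rintro ⟨h1, h2⟩
    exact ⟨h2, fun η hη => hF (Order.lt_add_one_iff.1 hη) h1⟩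
  · rintro ⟨h1, h2⟩
    exact ⟨h2 _ (Order.lt_add_one_iff.2 le_rfl), h1⟩

/-- Exit stages are unique, and a point without one never leaves. The complement is thus again
layers plus a closed set, which yields the `G_δ` half. -/
theorem compl_iUnion_exitLayer {X : Type u} (F : Ordinal.{u} → Set X) (A : Set Ordinal.{u}) :
    (⋃ ξ ∈ A, exitLayer F ξ)ᶜ = (⋃ ξ ∈ Aᶜ, exitLayer F ξ) ∪ ⋂ ξ, F ξ := by
  ext x
  simp only [mem_compl_iff, mem_iUnion, mem_union, mem_iInter, not_exists, exists_prop, not_and]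
  constructor
  · intro h
    by_cases hx : ∀ ξ, x ∈ F ξ
    · exact Or.inr hx
    · push Not at hx
      obtain ⟨ξ, hξ⟩ := hx
      obtain ⟨η, -, hη⟩ := exists_mem_exitLayer hξ
      exact Or.inl ⟨η, fun hA => h η hA hη, hη⟩
  · rintro (⟨ξ, hξ, hx⟩ | h) η hη hxη
    · exact hξ (eq_of_mem_exitLayer hx hxη ▸ hη)
    · exact hxη.1 (h η)

theorem IsResolvableSet.isDeltaZeroTwo {X : Type u} [TopologicalSpace X]
    [TopologicalSpace.MetrizableSpace X] {E : Set X} (hE : IsResolvableSet E) :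
    IsDeltaZeroTwo E := by
  let := TopologicalSpace.metrizableSpaceMetric X
  obtain ⟨α, F, hF, hanti, rfl⟩ := hE
  rw [iUnion_sdiff_eq_iUnion_exitLayer hanti]
  refine ⟨isFSigmaSet_iUnion_exitLayer hF _, ?_⟩
  have h1 := isFSigmaSet_iff_isGδ_compl.1
    (isFSigmaSet_iUnion_exitLayer hF ((fun ξ => 2 * ξ + 1) '' Iio α)ᶜ)
  have h2 : IsGδ (⋂ ξ, F ξ)ᶜ := (isClosed_iInter hF).isOpen_compl.isGδ
  have h3 := h1.inter h2
  rwa [← compl_union, ← compl_iUnion_exitLayer, compl_compl] at h3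

/-- On every nonempty closed set a resolvable set is somewhere locally constant. -/
theorem IsResolvableSet.not_dense_and_codense {X : Type u} [TopologicalSpace X] {E K : Set X}
    (hE : IsResolvableSet E) (hK : K.Nonempty) (h1 : K ⊆ closure (K ∩ E))
    (h2 : K ⊆ closure (K \ E)) : False := by
  obtain ⟨α, F, hF, hanti, rfl⟩ := hE
  rw [iUnion_sdiff_eq_iUnion_exitLayer hanti] at h1 h2
  have hex : ∃ ξ, ¬ K ⊆ F ξ := by
    by_contra! h
    obtain ⟨x, hx⟩ := hK
    obtain ⟨y, hyK, hy⟩ := closure_nonempty_iff.1 ⟨x, h1 hx⟩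
    simp only [mem_iUnion] at hy
    obtain ⟨ξ, -, hy⟩ := hy
    exact hy.1 (h ξ hyK)
  -- For the least such `ξ`, the nonempty relatively open set `K \ F ξ` lies in a single layer,
  -- hence entirely inside or entirely outside the resolvable set.
  obtain ⟨ξ, hξ, hmin⟩ := WellFounded.has_min (wellFounded_lt (α := Ordinal.{u})) _ hex
  have hlayer : ∀ y ∈ K, y ∉ F ξ → y ∈ exitLayer F ξ := fun y hy hyF =>
    ⟨hyF, fun η hη => by_contra fun h => hmin η (fun hs => h (hs hy)) hη⟩
  obtain ⟨x, hxK, hxF⟩ := not_subset.1 hξ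
  obtain ⟨y, hyF, hyK, hy⟩ := mem_closure_iff.1 (h1 hxK) _ (hF ξ).isOpen_compl hxF
  obtain ⟨z, hzF, hzK, hz⟩ := mem_closure_iff.1 (h2 hxK) _ (hF ξ).isOpen_compl hxF
  simp only [mem_iUnion] at hy hz
  obtain ⟨η, hηA, hη⟩ := hy
  have := eq_of_mem_exitLayer hη (hlayer y hyK hyF)
  subst this
  exact hz ⟨η, hηA, hlayer z hzK hzF⟩

/-! ### The alternating derivation in completely Baire spaces -/

/-- The alternating derivation of a set `E`: take the closure of the part in `E` at even stages
and of the part outside `E` at odd stages. -/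
noncomputable def alternatingDerivation {X : Type u} [TopologicalSpace X] (E : Set X)
    (ξ : Ordinal.{u}) : Set X :=
  closure ((⋂ η : Iio ξ, alternatingDerivation E η.1) ∩ {x | x ∈ E ↔ ξ % 2 = 0})
termination_by ξ
decreasing_by exact η.2

theorem antitone_alternatingDerivation {X : Type u} [TopologicalSpace X] (E : Set X) :
    Antitone (alternatingDerivation E) := by
  intro η ξ h
  rcases h.eq_or_lt with rfl | h
  · exact le_rfl
  · rw [alternatingDerivation.eq_1 E ξ]
    have hc : IsClosed (⋂ η : Iio ξ, alternatingDerivation E η.1) :=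
      isClosed_iInter fun η => by rw [alternatingDerivation]; exact isClosed_closure
    exact (closure_minimal inter_subset_left hc).trans (iInter_subset_of_subset ⟨η, h⟩ le_rfl)

theorem alternatingDerivation_add_one {X : Type u} [TopologicalSpace X] (E : Set X)
    (ξ : Ordinal.{u}) : alternatingDerivation E (ξ + 1) =
      closure (alternatingDerivation E ξ ∩ {x | x ∈ E ↔ (ξ + 1) % 2 = 0}) := by
  rw [alternatingDerivation.eq_1 E (ξ + 1)]
  congr 2
  refine Subset.antisymm
    (iInter_subset_of_subset ⟨ξ, mem_Iio.2 (Order.lt_add_one_iff.2 le_rfl)⟩ le_rfl) ?_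
  exact subset_iInter fun η => antitone_alternatingDerivation E (Order.lt_add_one_iff.1 η.2)

theorem Ordinal.two_mul_add_one_mod_two (ξ : Ordinal.{u}) : (2 * ξ + 1) % 2 = 1 := by
  rw [Ordinal.mul_add_mod_self, Ordinal.mod_eq_of_lt]
  exact_mod_cast Nat.one_lt_two

theorem Ordinal.two_mul_add_one_add_one (ξ : Ordinal.{u}) : 2 * ξ + 1 + 1 = 2 * (ξ + 1) := by
  rw [mul_add, mul_one, add_assoc, one_add_one_eq_two]

theorem IsDeltaZeroTwo.isResolvableSet {X : Type u} [TopologicalSpace X]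
    (hX : IsCompletelyBaire X) {E : Set X} (hE : IsDeltaZeroTwo E) : IsResolvableSet E := by
  set D := alternatingDerivation E with hD
  have hanti : Antitone D := antitone_alternatingDerivation E
  have hcl : ∀ ξ, IsClosed (D ξ) := fun ξ => by
    rw [hD, alternatingDerivation]; exact isClosed_closure
  -- The ordinals do not inject into `Set X`, so two even stages agree. Monotonicity then freezes
  -- the derivation through an odd stage and an even one.
  obtain ⟨a, b, hab, hlt⟩ : ∃ a b, D (2 * a) = D (2 * b) ∧ a < b := by
    have h := not_injective_of_ordinal (fun ξ => D (2 * ξ))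
    simp only [Function.Injective, not_forall] at h
    obtain ⟨a, b, h, hne⟩ := h
    rcases lt_or_gt_of_ne hne with hl | hl
    · exact ⟨a, b, h, hl⟩
    · exact ⟨b, a, h.symm, hl⟩
  have hb : 2 * a + 1 + 1 ≤ 2 * b := by
    rw [Ordinal.two_mul_add_one_add_one]
    exact mul_le_mul_right (Order.add_one_le_of_lt hlt) 2
  have e1 : D (2 * a + 1) = D (2 * a) :=
    (hanti le_self_add).antisymm (hab.trans_le (hanti (le_self_add.trans hb)))
  have e2 : D (2 * a + 1 + 1) = D (2 * a) :=
    (hanti (le_self_add.trans le_self_add)).antisymm (hab.trans_le (hanti hb))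
  have hempty : D (2 * a) = ∅ := by
    set K := D (2 * a) with hK
    have hB := hX K (hcl _)
    have c1 : K ⊆ closure (K ∩ Eᶜ) := by
      have := alternatingDerivation_add_one E (2 * a)
      rw [← hD, e1, Ordinal.two_mul_add_one_mod_two] at this
      conv_lhs => rw [this]
      simp only [one_ne_zero, iff_false]
      exact subset_rfl
    have c2 : K ⊆ closure (K ∩ E) := by
      have := alternatingDerivation_add_one E (2 * a + 1)
      rw [← hD, e2, e1, Ordinal.two_mul_add_one_add_one, Ordinal.mul_mod] at this
      conv_lhs => rw [this]
      simp only [iff_true]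
      exact subset_rfl
    obtain ⟨g1, g2⟩ := isDeltaZeroTwo_iff.1 hE
    have d : ∀ S : Set X, K ⊆ closure (K ∩ S) → Dense ((↑) ⁻¹' S : Set K) := fun S hS => by
      rw [Subtype.dense_iff, Subtype.image_preimage_coe]
      exact hS
    have h := (d _ c2).inter_of_Gδ (g2.preimage continuous_subtype_val)
      (g1.preimage continuous_subtype_val) (d _ c1)
    rw [← preimage_inter, inter_compl_self, preimage_empty] at h
    refine eq_empty_of_forall_notMem fun x hx => ?_
    simpa using h ⟨x, hx⟩
  refine ⟨a, D, hcl, hanti, ?_⟩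
  rw [iUnion_sdiff_eq_iUnion_exitLayer hanti]
  -- A point of the parity kept at stage `ξ` cannot leave there, so points of `E` leave at odd
  -- stages and the others at even stages.
  have hpar : ∀ ξ x, x ∈ exitLayer D ξ → ¬ (x ∈ E ↔ ξ % 2 = 0) := fun ξ x hx h => by
    refine hx.1 ?_
    rw [hD, alternatingDerivation]
    exact subset_closure ⟨mem_iInter.2 fun η => hx.2 η.1 η.2, h⟩
  ext x
  simp only [mem_iUnion, exists_prop, mem_image, mem_Iio]
  constructor
  · intro hx
    obtain ⟨ξ, hξ, hxξ⟩ := exists_mem_exitLayer (F := D) (x := x) (ξ := 2 * a) (by simp [hempty])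
    have h2 : ξ % 2 = 1 := by
      have h0 : ξ % 2 ≠ 0 := fun h => hpar ξ x hxξ (by simp [hx, h])
      have hl : ξ % 2 < 2 := Ordinal.mod_lt ξ two_ne_zero
      replace hl : ξ % 2 ≤ 1 := Order.lt_add_one_iff.1 (hl.trans_eq one_add_one_eq_two.symm)
      exact hl.antisymm (Order.one_le_iff_pos.2 (pos_iff_ne_zero.2 h0))
    have h3 := Ordinal.div_add_mod ξ 2
    rw [h2] at h3
    refine ⟨ξ, ⟨ξ / 2, ?_, h3⟩, hxξ⟩
    by_contra! hle
    have : 2 * a < ξ := by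
      rw [← h3, Order.lt_add_one_iff]
      exact mul_le_mul_right hle 2
    exact absurd hξ this.not_ge
  · rintro ⟨_, ⟨ξ, -, rfl⟩, hx⟩
    have := hpar _ x hx
    rw [Ordinal.two_mul_add_one_mod_two] at this
    simpa using this

/-! ### Labelling the rationals by finite sequences -/

/-- `InBranch s m t` says that `t = s` or `t` extends `s ++ [n]` for some `n ≥ m`. -/
def InBranch : List ℕ → ℕ → List ℕ → Prop
  | [], _, [] => True
  | [], m, n :: _ => m ≤ n
  | _ :: _, _, [] => False
  | k :: s, m, j :: t => j = k ∧ InBranch s m t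

theorem inBranch_self (s : List ℕ) (m : ℕ) : InBranch s m s := by
  induction s with
  | nil => trivial
  | cons k s ih => exact ⟨rfl, ih⟩

theorem inBranch_append_singleton (s : List ℕ) (m : ℕ) : InBranch s m (s ++ [m]) := by
  induction s with
  | nil => exact le_rfl (a := m)
  | cons k s ih => exact ⟨rfl, ih⟩

/-- The position of a finite sequence of naturals on the rational line. The sequences extending
`[n]` are placed in a small interval around `(-1/4) ^ n`. -/
def treePos : List ℕ → ℚ
  | [] => 0
  | n :: s => (-1 / 4) ^ n + (1 / 4) ^ (n + 1) * treePos s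

/-- The bound closes up since `1 + 2/4 < 2`. It keeps the block of `[n]` within half of `(1/4) ^ n`
of its centre; the alternating signs make blocks approach `0` from both sides. -/
theorem abs_treePos_lt (s : List ℕ) : |treePos s| < 2 := by
  induction s with
  | nil => simp [treePos]
  | cons n s ih =>
    have h1 : ((1 : ℚ) / 4) ^ n ≤ 1 := pow_le_one₀ (by norm_num) (by norm_num)
    have h0 : 0 < ((1 : ℚ) / 4) ^ n := by positivity
    have h2 : |((-1 : ℚ) / 4) ^ n| = (1 / 4) ^ n := by rw [abs_pow]; norm_num
    calc |treePos (n :: s)| ≤ |((-1 : ℚ) / 4) ^ n| + |(1 / 4) ^ (n + 1) * treePos s| :=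
          abs_add_le _ _
      _ = (1 / 4) ^ n + (1 / 4) ^ n * (1 / 4) * |treePos s| := by
          rw [h2, abs_mul, abs_of_pos (by positivity : (0 : ℚ) < (1 / 4) ^ (n + 1)), pow_succ]
      _ < 2 := by nlinarith

theorem abs_treePos_cons_sub_lt (n : ℕ) (s : List ℕ) :
    |treePos (n :: s) - (-1 / 4) ^ n| < (1 / 4) ^ n / 2 := by
  have h0 : 0 < ((1 : ℚ) / 4) ^ n := by positivity
  rw [treePos, add_sub_cancel_left, abs_mul,
    abs_of_pos (by positivity : (0 : ℚ) < (1 / 4) ^ (n + 1)), pow_succ]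
  nlinarith [abs_treePos_lt s]

theorem abs_treePos_cons_lt (n : ℕ) (s : List ℕ) :
    |treePos (n :: s)| < 3 / 2 * (1 / 4) ^ n := by
  have h2 : |((-1 : ℚ) / 4) ^ n| = (1 / 4) ^ n := by rw [abs_pow]; norm_num
  have := abs_sub_abs_le_abs_sub (treePos (n :: s)) ((-1 / 4) ^ n)
  have := abs_treePos_cons_sub_lt n s
  linarith

theorem abs_treePos_cons_lt_of_lt {n m : ℕ} (h : n < m) (s : List ℕ) :
    |treePos (m :: s)| < (1 / 4) ^ n / 2 := by
  have h0 : 0 < ((1 : ℚ) / 4) ^ n := by positivity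
  have h1 : ((1 : ℚ) / 4) ^ m ≤ (1 / 4) ^ (n + 1) :=
    pow_le_pow_of_le_one (by norm_num) (by norm_num) h
  have := abs_treePos_cons_lt m s
  rw [pow_succ] at h1
  linarith

theorem lt_treePos_cons_of_even {n : ℕ} (hn : Even n) (s : List ℕ) :
    (1 / 4) ^ n / 2 < treePos (n :: s) := by
  have h := (abs_lt.1 (abs_treePos_cons_sub_lt n s)).1
  have h1 : ((-1 : ℚ) / 4) ^ n = (1 / 4) ^ n := by rw [neg_div, hn.neg_pow]
  rw [h1] at h
  linarith

theorem treePos_cons_lt_of_odd {n : ℕ} (hn : Odd n) (s : List ℕ) :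
    treePos (n :: s) < -((1 / 4) ^ n / 2) := by
  have h := (abs_lt.1 (abs_treePos_cons_sub_lt n s)).2
  have h1 : ((-1 : ℚ) / 4) ^ n = -(1 / 4) ^ n := by rw [neg_div, hn.neg_pow]
  rw [h1] at h
  linarith

theorem treePos_cons_pos {n : ℕ} (hn : Even n) (s : List ℕ) : 0 < treePos (n :: s) :=
  lt_trans (by positivity) (lt_treePos_cons_of_even hn s)

theorem treePos_cons_neg {n : ℕ} (hn : Odd n) (s : List ℕ) : treePos (n :: s) < 0 :=
  (treePos_cons_lt_of_odd hn s).trans (neg_lt_zero.2 (by positivity))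

theorem treePos_cons_lt_cons_of_even {n m : ℕ} (hn : Even n) (h : n < m) (s t : List ℕ) :
    treePos (m :: t) < treePos (n :: s) :=
  ((le_abs_self _).trans_lt (abs_treePos_cons_lt_of_lt h t)).trans (lt_treePos_cons_of_even hn s)

theorem treePos_cons_lt_cons_of_odd {n m : ℕ} (hn : Odd n) (h : n < m) (s t : List ℕ) :
    treePos (n :: s) < treePos (m :: t) :=
  (treePos_cons_lt_of_odd hn s).trans (abs_lt.1 (abs_treePos_cons_lt_of_lt h t)).1

theorem treePos_cons_lt_iff (n : ℕ) (s t : List ℕ) :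
    treePos (n :: s) < treePos (n :: t) ↔ treePos s < treePos t := by
  have h0 : 0 < ((1 : ℚ) / 4) ^ (n + 1) := by positivity
  rw [treePos, treePos, add_lt_add_iff_left, mul_lt_mul_iff_right₀ h0]

/-- The positions of the extensions of `[n]` and of `[m]` form separated blocks. -/
theorem treePos_cons_lt_or_lt {n m : ℕ} (h : n ≠ m) :
    (∀ s t, treePos (n :: s) < treePos (m :: t)) ∨ ∀ s t, treePos (m :: t) < treePos (n :: s) := by
  rcases lt_or_gt_of_ne h with h | h
  · rcases Nat.even_or_odd n with hn | hn
    · exact Or.inr fun s t => treePos_cons_lt_cons_of_even hn h s t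
    · exact Or.inl fun s t => treePos_cons_lt_cons_of_odd hn h s t
  · rcases Nat.even_or_odd m with hm | hm
    · exact Or.inl fun s t => treePos_cons_lt_cons_of_even hm h t s
    · exact Or.inr fun s t => treePos_cons_lt_cons_of_odd hm h t s

theorem treePos_cons_ne_zero (n : ℕ) (s : List ℕ) : treePos (n :: s) ≠ 0 := by
  rcases Nat.even_or_odd n with hn | hn
  · exact (treePos_cons_pos hn s).ne'
  · exact (treePos_cons_neg hn s).ne

theorem treePos_injective : Function.Injective treePos := by
  intro s
  induction s with
  | nil =>
    rintro (_ | ⟨n, t⟩) h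
    · rfl
    · exact absurd h.symm (treePos_cons_ne_zero n t)
  | cons n s ih =>
    rintro (_ | ⟨m, t⟩) h
    · exact absurd h (treePos_cons_ne_zero n s)
    · by_cases hnm : n = m
      · subst hnm
        have h0 : ((1 : ℚ) / 4) ^ (n + 1) ≠ 0 := by positivity
        rw [treePos, treePos, add_right_inj, mul_right_inj' h0] at h
        rw [ih h]
      · rcases treePos_cons_lt_or_lt hnm with h' | h'
        · exact absurd h (h' s t).ne
        · exact absurd h (h' s t).ne'

theorem exists_treePos_gt (s : List ℕ) : ∃ t, treePos s < treePos t := by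
  induction s with
  | nil => exact ⟨[0], treePos_cons_pos Even.zero []⟩
  | cons n s ih =>
    obtain ⟨t, ht⟩ := ih
    exact ⟨n :: t, (treePos_cons_lt_iff n s t).2 ht⟩

theorem exists_treePos_lt (s : List ℕ) : ∃ t, treePos t < treePos s := by
  induction s with
  | nil => exact ⟨[1], treePos_cons_neg odd_one []⟩
  | cons n s ih =>
    obtain ⟨t, ht⟩ := ih
    exact ⟨n :: t, (treePos_cons_lt_iff n t s).2 ht⟩

theorem exists_treePos_between {s t : List ℕ} (h : treePos s < treePos t) :
    ∃ r, treePos s < treePos r ∧ treePos r < treePos t := by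
  induction s generalizing t with
  | nil =>
    rcases t with _ | ⟨n, t⟩
    · exact absurd h (lt_irrefl _)
    · have hn : Even n := by
        by_contra hn
        exact (treePos_cons_neg (Nat.not_even_iff_odd.1 hn) t).not_gt h
      -- Index `n + 2` keeps the sign of block `n` and lies closer to `0`.
      have h2 : Even (n + 2) := hn.add even_two
      exact ⟨[n + 2], treePos_cons_pos h2 [], treePos_cons_lt_cons_of_even hn (by omega) t []⟩
  | cons n s ih =>
    rcases t with _ | ⟨m, t⟩
    · have hn : Odd n := by
        by_contra hn
        exact (treePos_cons_pos (Nat.not_odd_iff_even.1 hn) s).not_gt h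
      have h2 : Odd (n + 2) := hn.add_even even_two
      exact ⟨[n + 2], treePos_cons_lt_cons_of_odd hn (by omega) s [], treePos_cons_neg h2 []⟩
    · by_cases hnm : n = m
      · subst hnm
        obtain ⟨r, h1, h2⟩ := ih ((treePos_cons_lt_iff n s t).1 h)
        exact ⟨n :: r, (treePos_cons_lt_iff n s r).2 h1, (treePos_cons_lt_iff n r t).2 h2⟩
      · obtain ⟨r, hr⟩ := exists_treePos_gt s
        refine ⟨n :: r, (treePos_cons_lt_iff n s r).2 hr, ?_⟩
        rcases treePos_cons_lt_or_lt hnm with h' | h'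
        · exact h' r t
        · exact absurd h (h' s t).not_gt

/-- Finite sequences of naturals, ordered by their positions, are order isomorphic to `ℚ`. -/
theorem exists_equiv_rat_lt_iff_treePos_lt :
    ∃ h : List ℕ ≃ ℚ, ∀ s t, h s < h t ↔ treePos s < treePos t := by
  have : DenselyOrdered (range treePos) := ⟨by
    rintro ⟨_, s, rfl⟩ ⟨_, t, rfl⟩ h
    obtain ⟨r, h1, h2⟩ := exists_treePos_between h
    exact ⟨⟨_, r, rfl⟩, h1, h2⟩⟩
  have : NoMaxOrder (range treePos) := ⟨by
    rintro ⟨_, s, rfl⟩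
    obtain ⟨r, hr⟩ := exists_treePos_gt s
    exact ⟨⟨_, r, rfl⟩, hr⟩⟩
  have : NoMinOrder (range treePos) := ⟨by
    rintro ⟨_, s, rfl⟩
    obtain ⟨r, hr⟩ := exists_treePos_lt s
    exact ⟨⟨_, r, rfl⟩, hr⟩⟩
  obtain ⟨e⟩ := Order.iso_of_countable_dense (range treePos) ℚ
  exact ⟨(Equiv.ofInjective treePos treePos_injective).trans e.toEquiv, fun s t =>
    e.lt_iff_lt⟩

theorem exists_treePos_Ioo_subset_inBranch (s : List ℕ) (m : ℕ) :
    ∃ a b, treePos a < treePos s ∧ treePos s < treePos b ∧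
      ∀ t, treePos a < treePos t → treePos t < treePos b → InBranch s m t := by
  induction s with
  | nil =>
    -- One endpoint of each sign, with index at least `m`, so that every block with index below `m`
    -- falls outside the interval.
    refine ⟨[2 * m + 1], [2 * m], treePos_cons_neg (odd_two_mul_add_one m) [],
      treePos_cons_pos (even_two_mul m) [], ?_⟩
    rintro (_ | ⟨n, t⟩) h1 h2
    · trivial
    · by_contra hlt
      replace hlt : n < m := not_le.1 hlt
      rcases Nat.even_or_odd n with hn | hn
      · exact h2.not_gt (treePos_cons_lt_cons_of_even hn (by omega) t [])
      · exact h1.not_gt (treePos_cons_lt_cons_of_odd hn (by omega) t [])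
  | cons k s ih =>
    obtain ⟨a, b, ha, hb, h⟩ := ih
    refine ⟨k :: a, k :: b, (treePos_cons_lt_iff k a s).2 ha, (treePos_cons_lt_iff k s b).2 hb, ?_⟩
    rintro (_ | ⟨j, t⟩) h1 h2
    · rcases Nat.even_or_odd k with hk | hk
      · exact h1.not_gt (treePos_cons_pos hk a)
      · exact h2.not_gt (treePos_cons_neg hk b)
    · by_cases hjk : j = k
      · subst hjk
        exact ⟨rfl, h t ((treePos_cons_lt_iff j a t).1 h1) ((treePos_cons_lt_iff j t b).1 h2)⟩
      · rcases treePos_cons_lt_or_lt hjk with h' | h'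
        · exact absurd h1 (h' t a).not_gt
        · exact absurd h2 (h' t b).not_gt

theorem exists_forall_inBranch_abs_treePos_sub_lt (s : List ℕ) {ε : ℚ} (hε : 0 < ε) :
    ∃ m, ∀ t, InBranch s m t → |treePos t - treePos s| < ε := by
  induction s with
  | nil =>
    obtain ⟨m, hm⟩ := exists_pow_lt_of_lt_one (half_pos hε) (by norm_num : (1 : ℚ) / 4 < 1)
    refine ⟨m, ?_⟩
    rintro (_ | ⟨n, t⟩) h
    · simpa using hε
    · have h1 : ((1 : ℚ) / 4) ^ n ≤ (1 / 4) ^ m :=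
        pow_le_pow_of_le_one (by norm_num) (by norm_num) h
      have h2 := abs_treePos_cons_lt n t
      rw [treePos.eq_1, sub_zero]
      have : 0 < ((1 : ℚ) / 4) ^ n := by positivity
      linarith
  | cons k s ih =>
    obtain ⟨m, hm⟩ := ih
    refine ⟨m, ?_⟩
    rintro (_ | ⟨j, t⟩) h
    · exact h.elim
    · obtain ⟨rfl, h⟩ := h
      have h1 : ((1 : ℚ) / 4) ^ (j + 1) ≤ 1 := pow_le_one₀ (by norm_num) (by norm_num)
      rw [treePos, treePos, add_sub_add_left_eq_sub, ← mul_sub, abs_mul,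
        abs_of_pos (by positivity : (0 : ℚ) < (1 / 4) ^ (j + 1))]
      exact (mul_le_of_le_one_left (abs_nonneg _) h1).trans_lt (hm t h)

/-- The rationals can be labelled by the finite sequences of naturals in such a way that the sets
`InBranch s m` describe the neighbourhoods of the point labelled by `s`. -/
theorem exists_equiv_rat_hasBasis_inBranch : ∃ h : List ℕ ≃ ℚ, ∀ s,
    (comap h (𝓝 (h s))).HasBasis (fun _ : ℕ => True) fun m => {t | InBranch s m t} := by
  obtain ⟨h, hh⟩ := exists_equiv_rat_lt_iff_treePos_lt
  refine ⟨h, fun s => ((nhds_basis_Ioo (h s)).comap h).to_hasBasis ?_ ?_⟩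
  · rintro ⟨a, b⟩ ⟨ha, hb⟩
    obtain ⟨a, rfl⟩ := h.surjective a
    obtain ⟨b, rfl⟩ := h.surjective b
    simp only [hh] at ha hb
    obtain ⟨m, hm⟩ := exists_forall_inBranch_abs_treePos_sub_lt s
      (lt_min (sub_pos.2 ha) (sub_pos.2 hb))
    refine ⟨m, trivial, fun t ht => ?_⟩
    have h1 := hm t ht
    rw [lt_min_iff, abs_lt, abs_lt] at h1
    exact ⟨(hh a t).2 (by linarith [h1.1.1]), (hh t b).2 (by linarith [h1.2.2])⟩
  · rintro m -
    obtain ⟨a, b, ha, hb, hab⟩ := exists_treePos_Ioo_subset_inBranch s m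
    exact ⟨(h a, h b), ⟨(hh a s).2 ha, (hh s b).2 hb⟩, fun t ht =>
      hab t ((hh a t).1 ht.1) ((hh t b).1 ht.2)⟩

/-- Split by parity of the label's length: every neighbourhood of `s` contains some `s ++ [m]`, of
opposite parity. -/
theorem exists_dense_and_dense_compl_rat : ∃ S : Set ℚ, Dense S ∧ Dense Sᶜ := by
  obtain ⟨h, hh⟩ := exists_equiv_rat_hasBasis_inBranch
  have key : ∀ (P : List ℕ → Prop), (∀ s, P s ∨ ∀ m, P (s ++ [m])) → Dense {q | P (h.symm q)} := by
    intro P hP q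
    obtain ⟨s, rfl⟩ := h.surjective q
    rw [mem_closure_iff_nhds]
    intro U hU
    obtain ⟨m, -, hm⟩ := (hh s).mem_iff.1 (preimage_mem_comap hU)
    rcases hP s with hs | hs
    · exact ⟨h s, hm (inBranch_self s m), by simpa using hs⟩
    · exact ⟨h (s ++ [m]), hm (inBranch_append_singleton s m), by simpa using hs m⟩
  refine ⟨{q | Even (h.symm q).length}, key (fun s => Even s.length) fun s => ?_,
    key (fun s => ¬ Even s.length) fun s => ?_⟩
  · simp only [List.length_append, List.length_singleton, Nat.even_add_one]
    tauto
  · simp only [List.length_append, List.length_singleton, Nat.even_add_one]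
    tauto

/-! ### Branching schemes and closed copies of the rationals -/

/-- A rule that replaces a node, at each level `k`, by a sequence of pairwise disjoint nodes
converging to its centre and contained in `G k`. -/
structure BranchingScheme (Y : Type u) [TopologicalSpace Y] (G : ℕ → Set Y) where
  /-- the nodes -/
  Node : Type u
  /-- the centre of a node -/
  pt : Node → Y
  /-- an open neighbourhood of the centre -/
  inner : Node → Set Y
  /-- a closed set around the open neighbourhood -/
  outer : Node → Set Y
  /-- the successors of a node at a given level -/
  child : Node → ℕ → ℕ → Node
  pt_mem_inner : ∀ σ, pt σ ∈ inner σ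
  isOpen_inner : ∀ σ, IsOpen (inner σ)
  isClosed_outer : ∀ σ, IsClosed (outer σ)
  inner_subset_outer : ∀ σ, inner σ ⊆ outer σ
  outer_child_subset_inner : ∀ σ k n, outer (child σ k n) ⊆ inner σ
  outer_child_subset : ∀ σ k n, outer (child σ k n) ⊆ G k
  pt_notMem_outer_child : ∀ σ k n, pt σ ∉ outer (child σ k n)
  disjoint_outer_child : ∀ σ k, Pairwise fun n m =>
    Disjoint (outer (child σ k n)) (outer (child σ k m))
  tendsto_child : ∀ σ k, ∀ U ∈ 𝓝 (pt σ), ∃ m, ∀ n ≥ m, outer (child σ k n) ⊆ U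

namespace BranchingScheme

variable {Y : Type u} [TopologicalSpace Y] {G : ℕ → Set Y} (B : BranchingScheme Y G)

/-- The node reached from `σ` by a finite sequence of choices of successors. -/
def walk : B.Node → ℕ → List ℕ → B.Node
  | σ, _, [] => σ
  | σ, k, n :: s => walk (B.child σ k n) (k + 1) s

/-- The centre of the node reached from `σ` by a finite sequence of choices. -/
def walkPt (σ : B.Node) (k : ℕ) (s : List ℕ) : Y := B.pt (B.walk σ k s)

theorem walkPt_mem_inner (σ : B.Node) (k : ℕ) (s : List ℕ) : B.walkPt σ k s ∈ B.inner σ := by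
  induction s generalizing σ k with
  | nil => exact B.pt_mem_inner σ
  | cons n s ih =>
    exact B.outer_child_subset_inner σ k n (B.inner_subset_outer _ (ih (B.child σ k n) (k + 1)))

theorem walkPt_cons_mem_outer (σ : B.Node) (k n : ℕ) (s : List ℕ) :
    B.walkPt σ k (n :: s) ∈ B.outer (B.child σ k n) :=
  B.inner_subset_outer _ (B.walkPt_mem_inner (B.child σ k n) (k + 1) s)

theorem exists_nhds_inBranch (σ : B.Node) (k : ℕ) (s : List ℕ) (m : ℕ) :
    ∃ U ∈ 𝓝 (B.walkPt σ k s), ∀ t, B.walkPt σ k t ∈ U → InBranch s m t := by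
  induction s generalizing σ k with
  | nil =>
    refine ⟨⋂ n ∈ Iio m, (B.outer (B.child σ k n))ᶜ,
      (biInter_mem (finite_Iio m)).2 fun n _ =>
        (B.isClosed_outer _).isOpen_compl.mem_nhds (B.pt_notMem_outer_child σ k n), ?_⟩
    rintro (_ | ⟨n, t⟩) ht
    · trivial
    · by_contra hlt
      exact mem_iInter₂.1 ht n (not_le.1 hlt) (B.walkPt_cons_mem_outer σ k n t)
  | cons j s ih =>
    obtain ⟨U, hU, h⟩ := ih (B.child σ k j) (k + 1)
    refine ⟨U ∩ B.inner (B.child σ k j), inter_mem hU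
      ((B.isOpen_inner _).mem_nhds (B.walkPt_mem_inner _ _ s)), ?_⟩
    rintro (_ | ⟨n, t⟩) ht
    · exact B.pt_notMem_outer_child σ k j (B.inner_subset_outer _ ht.2)
    · by_cases hnj : n = j
      · subst hnj
        exact ⟨rfl, h t ht.1⟩
      · exact (disjoint_left.1 (B.disjoint_outer_child σ k hnj)
          (B.walkPt_cons_mem_outer σ k n t) (B.inner_subset_outer _ ht.2)).elim

theorem exists_forall_inBranch_walkPt_mem (σ : B.Node) (k : ℕ) (s : List ℕ) {U : Set Y}
    (hU : U ∈ 𝓝 (B.walkPt σ k s)) : ∃ m, ∀ t, InBranch s m t → B.walkPt σ k t ∈ U := by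
  induction s generalizing σ k with
  | nil =>
    obtain ⟨m, hm⟩ := B.tendsto_child σ k U hU
    refine ⟨m, ?_⟩
    rintro (_ | ⟨n, t⟩) ht
    · exact mem_of_mem_nhds hU
    · exact hm n ht (B.walkPt_cons_mem_outer σ k n t)
  | cons j s ih =>
    obtain ⟨m, hm⟩ := ih (B.child σ k j) (k + 1) hU
    refine ⟨m, ?_⟩
    rintro (_ | ⟨n, t⟩) ht
    · exact ht.elim
    · obtain ⟨rfl, ht⟩ := ht
      exact hm t ht

theorem hasBasis_comap_walkPt (σ : B.Node) (k : ℕ) (s : List ℕ) :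
    (comap (B.walkPt σ k) (𝓝 (B.walkPt σ k s))).HasBasis (fun _ : ℕ => True)
      fun m => {t | InBranch s m t} := by
  refine ((𝓝 (B.walkPt σ k s)).basis_sets.comap (B.walkPt σ k)).to_hasBasis ?_ ?_
  · intro U hU
    obtain ⟨m, hm⟩ := B.exists_forall_inBranch_walkPt_mem σ k s hU
    exact ⟨m, trivial, hm⟩
  · intro m _
    obtain ⟨U, hU, h⟩ := B.exists_nhds_inBranch σ k s m
    exact ⟨U, hU, h⟩

/-- Away from the centre only finitely many child subtrees matter, and closure commutes with finite
unions. -/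
theorem exists_child_mem_closure_range [T2Space Y] (σ : B.Node) (k : ℕ) {y : Y}
    (hy : y ∈ closure (range (B.walkPt σ k))) (hne : y ≠ B.pt σ) :
    ∃ n, y ∈ closure (range (B.walkPt (B.child σ k n) (k + 1))) := by
  by_contra! h
  obtain ⟨V, U, hV, hU, hyV, hσU, hVU⟩ := t2_separation hne
  obtain ⟨m, hm⟩ := B.tendsto_child σ k U (hU.mem_nhds hσU)
  have hW : V ∩ ⋂ n ∈ Iio m, (closure (range (B.walkPt (B.child σ k n) (k + 1))))ᶜ ∈ 𝓝 y :=
    inter_mem (hV.mem_nhds hyV) ((biInter_mem (finite_Iio m)).2 fun n _ =>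
      isClosed_closure.isOpen_compl.mem_nhds (h n))
  obtain ⟨_, ⟨hzV, hz⟩, s, rfl⟩ := mem_closure_iff_nhds.1 hy _ hW
  rcases s with _ | ⟨n, s⟩
  · exact disjoint_left.1 hVU hzV hσU
  · rcases lt_or_ge n m with hn | hn
    · exact mem_iInter₂.1 hz n hn (subset_closure ⟨s, rfl⟩)
    · exact disjoint_left.1 hVU hzV (hm n hn (B.walkPt_cons_mem_outer σ k n s))

/-- A limit point off the tree is never a centre, so it descends into a child at every level, and
the outer set of the child at level `k` lies in `G k`. -/
theorem mem_of_mem_closure_range [T2Space Y] (σ : B.Node) (k j : ℕ) {y : Y}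
    (hy : y ∈ closure (range (B.walkPt σ k))) (hy' : y ∉ range (B.walkPt σ k)) :
    y ∈ G (k + j) := by
  induction j generalizing σ k with
  | zero =>
    obtain ⟨n, hn⟩ := B.exists_child_mem_closure_range σ k hy fun h => hy' ⟨[], h.symm⟩
    refine B.outer_child_subset σ k n (closure_minimal ?_ (B.isClosed_outer _) hn)
    rintro _ ⟨s, rfl⟩
    exact B.walkPt_cons_mem_outer σ k n s
  | succ j ih =>
    obtain ⟨n, hn⟩ := B.exists_child_mem_closure_range σ k hy fun h => hy' ⟨[], h.symm⟩
    have := ih (B.child σ k n) (k + 1) hn fun ⟨s, hs⟩ => hy' ⟨n :: s, hs⟩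
    rwa [add_assoc, add_comm 1 j] at this

theorem isClosed_range_walkPt [T2Space Y] (σ : B.Node) (hσ : Disjoint (B.outer σ) (⋂ k, G k)) :
    IsClosed (range (B.walkPt σ 0)) := by
  refine isClosed_of_closure_subset fun y hy => by_contra fun hy' => ?_
  refine disjoint_left.1 hσ (closure_minimal ?_ (B.isClosed_outer σ) hy)
    (mem_iInter.2 fun j => zero_add j ▸ B.mem_of_mem_closure_range σ 0 j hy hy')
  rintro _ ⟨s, rfl⟩
  exact B.inner_subset_outer σ (B.walkPt_mem_inner σ 0 s)

theorem exists_isClosedEmbedding_rat [T2Space Y] (σ : B.Node)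
    (hσ : Disjoint (B.outer σ) (⋂ k, G k)) : ∃ f : ℚ → Y, IsClosedEmbedding f := by
  obtain ⟨h, hh⟩ := exists_equiv_rat_hasBasis_inBranch
  refine ⟨B.walkPt σ 0 ∘ h.symm, IsInducing.isEmbedding (isInducing_iff_nhds.2 fun q => ?_), ?_⟩
  · obtain ⟨s, rfl⟩ := h.surjective q
    have e : comap h (𝓝 (h s)) = comap (B.walkPt σ 0) (𝓝 (B.walkPt σ 0 s)) :=
      (hh s).eq_of_same_basis (B.hasBasis_comap_walkPt σ 0 s)
    rw [Function.comp_apply, h.symm_apply_apply, ← comap_comap, ← e, comap_comap,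
      h.self_comp_symm, comap_id]
  · rw [h.symm.surjective.range_comp]
    exact B.isClosed_range_walkPt σ hσ

end BranchingScheme

/-! ### Building a scheme where the Baire property fails -/

theorem exists_mem_dist_lt_of_notMem_iInter {Y : Type u} [MetricSpace Y] {G : ℕ → Set Y}
    (hGo : ∀ k, IsOpen (G k)) (hGd : ∀ k, Dense (G k)) {x : Y} (hx : x ∉ ⋂ k, G k) (k : ℕ)
    {ε : ℝ} (hε : 0 < ε) : ∃ z ∈ G k, 0 < dist z x ∧ dist z x < ε := by
  obtain ⟨j, hj⟩ : ∃ j, x ∉ G j := by simpa using hx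
  obtain ⟨z, hz, hzk, hzj⟩ := ((hGd k).inter_of_isOpen_left (hGd j) (hGo k)).inter_open_nonempty
    _ Metric.isOpen_ball ⟨x, Metric.mem_ball_self hε⟩
  exact ⟨z, hzk, dist_pos.2 fun h => hj (h ▸ hzj), hz⟩

theorem exists_seq_disjoint_closedBall {Y : Type u} [MetricSpace Y] {G : ℕ → Set Y}
    (hGo : ∀ k, IsOpen (G k)) (hGd : ∀ k, Dense (G k)) {x : Y} (hx : x ∉ ⋂ k, G k) (k : ℕ)
    {r : ℝ} (hr : 0 < r) : ∃ (z : ℕ → Y) (ρ : ℕ → ℝ), (∀ n, 0 < ρ n) ∧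
      (∀ n, Metric.closedBall (z n) (ρ n) ⊆ Metric.ball x r) ∧
      (∀ n, Metric.closedBall (z n) (ρ n) ⊆ G k) ∧
      (∀ n, x ∉ Metric.closedBall (z n) (ρ n)) ∧
      (Pairwise fun n m =>
        Disjoint (Metric.closedBall (z n) (ρ n)) (Metric.closedBall (z m) (ρ m))) ∧
      ∀ U ∈ 𝓝 x, ∃ m, ∀ n ≥ m, Metric.closedBall (z n) (ρ n) ⊆ U := by
  have hex : ∀ ε : ℝ, ∃ z, 0 < ε → z ∈ G k ∧ 0 < dist z x ∧ dist z x < ε := fun ε => by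
    by_cases hε : 0 < ε
    · obtain ⟨z, hz⟩ := exists_mem_dist_lt_of_notMem_iInter hGo hGd hx k hε
      exact ⟨z, fun _ => hz⟩
    · exact ⟨x, fun h => absurd h hε⟩
  choose g hg using hex
  let z : ℕ → Y := fun n => Nat.rec (g (r / 2)) (fun _ w => g (dist w x / 4)) n
  have hz0 := hg (r / 2) (half_pos hr)
  have hzs : ∀ n, 0 < dist (z n) x → z (n + 1) ∈ G k ∧ 0 < dist (z (n + 1)) x ∧
      dist (z (n + 1)) x < dist (z n) x / 4 := fun n h => hg (dist (z n) x / 4) (by positivity)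
  have hpos : ∀ n, 0 < dist (z n) x := fun n => by
    induction n with
    | zero => exact hz0.2.1
    | succ n ih => exact (hzs n ih).2.1
  have hzG : ∀ n, z n ∈ G k := fun n => by
    cases n with
    | zero => exact hz0.1
    | succ n => exact (hzs n (hpos n)).1
  have hstep : ∀ n, dist (z (n + 1)) x < dist (z n) x / 4 := fun n => (hzs n (hpos n)).2.2
  have hanti : Antitone fun n => dist (z n) x :=
    antitone_nat_of_succ_le fun n => by linarith [hstep n, hpos n]
  have hgeom : ∀ n, dist (z n) x ≤ r / 2 * (1 / 4) ^ n := fun n => by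
    induction n with
    | zero => rw [pow_zero, mul_one]; exact hz0.2.2.le
    | succ n ih => rw [pow_succ]; linarith [hstep n]
  have hball : ∀ n, ∃ δ > 0, Metric.closedBall (z n) δ ⊆ G k := fun n =>
    Metric.nhds_basis_closedBall.mem_iff.1 ((hGo k).mem_nhds (hzG n))
  choose δ hδ hδG using hball
  -- Each ball sits in an annulus about `x` with factors `3/4` and `5/4`. Distances shrink by more
  -- than a factor `4`, so these annuli are disjoint.
  have hlow : ∀ n, ∀ y ∈ Metric.closedBall (z n) (min (δ n) (dist (z n) x / 4)),
      3 / 4 * dist (z n) x ≤ dist y x ∧ dist y x ≤ 5 / 4 * dist (z n) x := fun n y hy => by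
    have h1 : dist y (z n) ≤ dist (z n) x / 4 :=
      (Metric.mem_closedBall.1 hy).trans (min_le_right _ _)
    have h2 := dist_triangle_left (z n) x y
    have h3 := dist_triangle y (z n) x
    constructor <;> linarith
  have hdisj : ∀ n m, n < m → Disjoint (Metric.closedBall (z n) (min (δ n) (dist (z n) x / 4)))
      (Metric.closedBall (z m) (min (δ m) (dist (z m) x / 4))) := fun n m h => by
    refine disjoint_left.2 fun y hy hy' => ?_
    have h1 := (hlow n y hy).1
    have h2 := (hlow m y hy').2
    have h3 : dist (z m) x ≤ dist (z (n + 1)) x := hanti h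
    linarith [hstep n, hpos n]
  refine ⟨z, fun n => min (δ n) (dist (z n) x / 4), fun n => lt_min (hδ n) (by linarith [hpos n]),
    fun n y hy => ?_, fun n => (Metric.closedBall_subset_closedBall (min_le_left _ _)).trans (hδG n),
    fun n h => ?_, fun n m hnm => ?_, fun U hU => ?_⟩
  · have h1 := (hlow n y hy).2
    have h2 : dist (z n) x ≤ dist (z 0) x := hanti (Nat.zero_le n)
    have h3 : dist (z 0) x < r / 2 := hz0.2.2
    rw [Metric.mem_ball]
    linarith
  · have h1 := (hlow n x h).1
    rw [dist_self] at h1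
    linarith [hpos n]
  · rcases lt_or_gt_of_ne hnm with h | h
    · exact hdisj n m h
    · exact (hdisj m n h).symm
  · obtain ⟨ε, hε, hεU⟩ := Metric.mem_nhds_iff.1 hU
    obtain ⟨m, hm⟩ := exists_pow_lt_of_lt_one (div_pos hε hr) (by norm_num : (1 : ℝ) / 4 < 1)
    rw [lt_div_iff₀ hr] at hm
    refine ⟨m, fun n hn y hy => hεU ?_⟩
    have h1 := (hlow n y hy).2
    have h2 : dist (z n) x ≤ dist (z m) x := hanti hn
    rw [Metric.mem_ball]
    linarith [hgeom m, hpos m]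

/-- Failure of the Baire property in a metric space produces a branching scheme and hence a closed
copy of the rationals. -/
theorem exists_isClosedEmbedding_rat_of_not_baireSpace {Y : Type u} [MetricSpace Y]
    (hY : ¬ BaireSpace Y) : ∃ f : ℚ → Y, IsClosedEmbedding f := by
  obtain ⟨G, hGo, hGd, hG⟩ : ∃ G : ℕ → Set Y, (∀ k, IsOpen (G k)) ∧ (∀ k, Dense (G k)) ∧
      ¬ Dense (⋂ k, G k) := by
    by_contra! h
    exact hY ⟨h⟩
  obtain ⟨x₀, hx₀⟩ : ∃ x, x ∉ closure (⋂ k, G k) := by simpa [Dense] using hG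
  obtain ⟨r₀, hr₀, hball⟩ :=
    Metric.nhds_basis_closedBall.mem_iff.1 (isClosed_closure.isOpen_compl.mem_nhds hx₀)
  -- Disjointness is carried by every node because it puts the centre outside `⋂ k, G k`, as the
  -- choice of children requires.
  let S := {σ : Y × ℝ // 0 < σ.2 ∧ Disjoint (Metric.closedBall σ.1 σ.2) (⋂ k, G k)}
  have hS : ∀ σ : S, σ.1.1 ∉ ⋂ k, G k := fun σ =>
    disjoint_left.1 σ.2.2 (Metric.mem_closedBall_self σ.2.1.le)
  choose z ρ hρ hsub hsubG hnot hdisj htend using fun (σ : S) (k : ℕ) =>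
    exists_seq_disjoint_closedBall hGo hGd (hS σ) k σ.2.1
  let B : BranchingScheme Y G :=
    { Node := S
      pt := fun σ => σ.1.1
      inner := fun σ => Metric.ball σ.1.1 σ.1.2
      outer := fun σ => Metric.closedBall σ.1.1 σ.1.2
      child := fun σ k n => ⟨(z σ k n, ρ σ k n), hρ σ k n,
        σ.2.2.mono_left ((hsub σ k n).trans Metric.ball_subset_closedBall)⟩
      pt_mem_inner := fun σ => Metric.mem_ball_self σ.2.1
      isOpen_inner := fun _ => Metric.isOpen_ball
      isClosed_outer := fun _ => Metric.isClosed_closedBall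
      inner_subset_outer := fun _ => Metric.ball_subset_closedBall
      outer_child_subset_inner := hsub
      outer_child_subset := hsubG
      pt_notMem_outer_child := hnot
      disjoint_outer_child := hdisj
      tendsto_child := htend }
  have hσ : Disjoint (Metric.closedBall x₀ r₀) (⋂ k, G k) :=
    disjoint_left.2 fun y hy hy' => hball hy (subset_closure hy')
  exact B.exists_isClosedEmbedding_rat ⟨(x₀, r₀), hr₀, hσ⟩ hσ

/-! ### The implications -/

theorem isCompletelyBaire_of_isEmpty_homeomorph_rat {X : Type u} [TopologicalSpace X]
    [TopologicalSpace.MetrizableSpace X]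
    (h : ∀ F : Set X, IsClosed F → IsEmpty (F ≃ₜ ℚ)) : IsCompletelyBaire X := by
  let := TopologicalSpace.metrizableSpaceMetric X
  intro F hF
  by_contra hB
  obtain ⟨f, hf⟩ := exists_isClosedEmbedding_rat_of_not_baireSpace hB
  have hg := hF.isClosedEmbedding_subtypeVal.comp hf
  exact (h _ hg.isClosed_range).false hg.isEmbedding.toHomeomorph.symm

/-- A closed copy of the rationals contains a `Δ⁰₂` set that is not resolvable. -/
theorem exists_isDeltaZeroTwo_not_isResolvableSet {X : Type u} [TopologicalSpace X]
    [TopologicalSpace.MetrizableSpace X] {F : Set X} (hF : IsClosed F) (e : F ≃ₜ ℚ) :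
    ∃ E : Set X, IsDeltaZeroTwo E ∧ ¬ IsResolvableSet E := by
  let := TopologicalSpace.metrizableSpaceMetric X
  obtain ⟨S, hS, hS'⟩ := exists_dense_and_dense_compl_rat
  have hd : ∀ T : Set ℚ, Dense T → F ⊆ closure ((↑) '' (e ⁻¹' T)) := fun T hT =>
    Subtype.dense_iff.1 (hT.preimage e.isOpenMap)
  have hc : ∀ T : Set ℚ, IsGδ ((↑) '' (e ⁻¹' T) : Set X)ᶜ := fun T =>
    (((to_countable T).preimage e.injective).image _).isGδ_compl
  refine ⟨(↑) '' (e ⁻¹' S), isDeltaZeroTwo_iff.2 ⟨hc S, ?_⟩, fun hE => ?_⟩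
  -- The set is `F` minus a countable set, hence `G_δ`.
  · have h : ((↑) '' (e ⁻¹' S) : Set X) = F ∩ ((↑) '' (e ⁻¹' Sᶜ))ᶜ := by
      ext x
      simp only [mem_image, mem_preimage, Subtype.exists, exists_and_right, exists_eq_right,
        mem_inter_iff, mem_compl_iff, not_exists, not_not]
      exact ⟨fun ⟨hx, h⟩ => ⟨hx, fun _ => h⟩, fun ⟨hx, h⟩ => ⟨hx, h hx⟩⟩
    rw [h]
    exact hF.isGδ.inter (hc Sᶜ)
  · refine hE.not_dense_and_codense (K := F) ⟨_, (e.symm 0).2⟩ ?_ ?_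
    · refine (hd S hS).trans (closure_mono ?_)
      exact subset_inter (Subtype.coe_image_subset F _) subset_rfl
    · refine (hd Sᶜ hS').trans (closure_mono ?_)
      rintro _ ⟨x, hx, rfl⟩
      refine ⟨x.2, ?_⟩
      rintro ⟨y, hy, hxy⟩
      exact hx (Subtype.ext hxy ▸ hy)

theorem lemma5 (X : Type u) [TopologicalSpace X] [TopologicalSpace.MetrizableSpace X] :
    List.TFAE [
      ∀ F : Set X, IsClosed F → IsEmpty (F ≃ₜ ℚ),
      IsCompletelyBaire X,
      ∀ E : Set X, IsDeltaZeroTwo E ↔ IsResolvableSet E] := by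
  tfae_have 1 → 2 := isCompletelyBaire_of_isEmpty_homeomorph_rat
  tfae_have 2 → 3 := fun h E =>
    ⟨fun hE => hE.isResolvableSet h, fun hE => hE.isDeltaZeroTwo⟩
  tfae_have 3 → 1 := fun h F hF => ⟨fun e => by
    obtain ⟨E, hE, hE'⟩ := exists_isDeltaZeroTwo_not_isResolvableSet hF e
    exact hE' ((h E).1 hE)⟩
  tfae_finish
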